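/- **Setting.** Let $q$ be a positive integer, $\alpha\in\mathbb R$, $\kappa\in\{0,1,2,\dots\}\cup\{+\infty\}$, and let $(s_j)_{j=0}^\kappa$ be a sequence of complex $q\times q$ matrices. Here and below, indices are (finite) nonnegative integers, even if $\kappa=+\infty$. Write $H_n=(s_{j+k})_{j,k=0}^n$ and $K_n=(s_{j+k+1})_{j,k=0}^n$ for the block Hankel matrices, and $A^\dagger$ for the Moore–Penrose inverse of $A$. *Classes.* For finite $\kappa$, the sequence belongs to $\mathcal K^{\ge}_{q,\kappa,\alpha}$ (resp. $\mathcal K^{>}_{q,\kappa,\alpha}$) if the following matrices are nonnegative Hermitian (resp. positive Hermitian): $H_0$ if $\kappa=0$; $H_n$ and $-\alpha H_{n-1}+K_{n-1}$ if $\kappa=2n$ with $n\ge1$; $H_n$ and $-\alpha H_n+K_n$ if $\kappa=2n+1$ with $n\ge0$. For $\kappa=+\infty$, it belongs to $\mathcal K^{\ge}_{q,\infty,\alpha}$ (resp. $\mathcal K^{>}_{q,\infty,\alpha}$) if $(s_j)_{j=0}^m$ belongs to $\mathcal K^{\ge}_{q,m,\alpha}$ (resp. $\mathcal K^{>}_{q,m,\alpha}$)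 for every integer $m\ge0$. *Schur transforms.* Given a sequence $(t_j)_{j=0}^{\tau}$ of complex $q\times q$ matrices with $\tau\ge1$, let $u_0=t_0$ and $u_j=-\alpha t_{j-1}+t_j$ for $j\ge1$, and let $r_0=u_0^\dagger$ and $r_j=-u_0^\dagger\sum_{l=0}^{j-1}u_{j-l}r_l$ for $j\ge1$. The first $\alpha$-Schur transform of $(t_j)_{j=0}^\tau$ is the sequence $(-t_0\,r_{j+1}\,t_0)_{j=0}^{\tau-1}$. Put $s_j^{[0,\alpha]}=s_j$, and for $1\le k\le\kappa$ let $(s_j^{[k,\alpha]})_{j=0}^{\kappa-k}$ be the first $\alpha$-Schur transform of $(s_j^{[k-1,\alpha]})_{j=0}^{\kappa-(k-1)}$. *Corrections.* For $0\le k\le\kappa$ and $0\le j\le\kappa-k$ let $$P_{j}^{[k]}=s_j^{[k,\alpha]}-s_0^{[k,\alpha]}\bigl(s_0^{[k,\alpha]}\bigr)^\dagger s_j^{[k,\alpha]}\bigl(s_0^{[k,\alpha]}\bigr)^\dagger s_0^{[k,\alpha]},$$ and for $0\le m\le l\le\kappa$ let $Z_{l}^{[m]}=\sum_{k=0}^{m-1}P_{l-k}^{[k]}$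 (so $Z_l^{[0]}=0$). **Proposition.** Suppose that $(s_j)_{j=0}^\kappa\in\mathcal K^{\ge}_{q,\kappa,\alpha}$. Then the following are equivalent: 1. $(s_j)_{j=0}^\kappa\in\mathcal K^{>}_{q,\kappa,\alpha}$. 2. For every $k$ with $0\le k\le\kappa$, the matrix $s_0^{[k,\alpha]}$ is nonsingular. If (1) holds, then $s_0^{[k,\alpha]}$ is positive Hermitian for all $0\le k\le\kappa$; moreover $P_{j}^{[k]}=0$ for all $0\le k\le\kappa$ and $0\le j\le\kappa-k$, and $Z_{l}^{[m]}=0$ for all $0\le m\le l\le\kappa$. -/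

import Mathlib

open scoped ComplexOrder

noncomputable section

namespace StieltjesSchur

open Matrix

/-! ### Moore-Penrose inverse -/

/-- `X` satisfies the four Penrose equations for the complex matrix `A`. -/
structure IsMoorePenrose {p q : ℕ} (A : Matrix (Fin p) (Fin q) ℂ) (X : Matrix (Fin q) (Fin p) ℂ) :
    Prop where
  mul_mul : A * X * A = A
  mul_mul_inv : X * A * X = X
  left_herm : (A * X)ᴴ = A * X
  right_herm : (X * A)ᴴ = X * A

theorem exists_isMoorePenrose {p q : ℕ} (A : Matrix (Fin p) (Fin q) ℂ) :
    ∃ X, IsMoorePenrose A X := by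
  have hB : (Aᴴ * A).IsHermitian := isHermitian_conjTranspose_mul_self A
  -- a Hermitian generalized inverse `C` of `Aᴴ * A` that commutes with it
  obtain ⟨C, hC, h1, h2, h3⟩ : ∃ C : Matrix (Fin q) (Fin q) ℂ, Cᴴ = C ∧
      (Aᴴ * A) * C * (Aᴴ * A) = Aᴴ * A ∧ C * (Aᴴ * A) * C = C ∧
      (Aᴴ * A) * C = C * (Aᴴ * A) := by
    have hs := hB.spectral_theorem
    set U : Matrix (Fin q) (Fin q) ℂ := (hB.eigenvectorUnitary : Matrix (Fin q) (Fin q) ℂ) with hU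
    have hUU : Uᴴ * U = 1 := by
      have := (Matrix.mem_unitaryGroup_iff').1 hB.eigenvectorUnitary.2
      simpa [star_eq_conjTranspose] using this
    set d : Fin q → ℂ := fun i => (hB.eigenvalues i : ℂ) with hd
    have hs2 : Aᴴ * A = U * diagonal d * Uᴴ := by
      conv_lhs => rw [hs]
      simp [Unitary.conjStarAlgAut_apply, hU, hd, star_eq_conjTranspose, Function.comp_def]
    have key : ∀ a b : Fin q → ℂ, (U * diagonal a * Uᴴ) * (U * diagonal b * Uᴴ)
        = U * diagonal (fun i => a i * b i) * Uᴴ := by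
      intro a b
      calc _ = U * diagonal a * (Uᴴ * U) * diagonal b * Uᴴ := by simp only [Matrix.mul_assoc]
        _ = _ := by rw [hUU, Matrix.mul_one, Matrix.mul_assoc U, diagonal_mul_diagonal]
    refine ⟨U * diagonal (fun i => (d i)⁻¹) * Uᴴ, ?_, ?_, ?_, ?_⟩
    · simp only [conjTranspose_mul, conjTranspose_conjTranspose, diagonal_conjTranspose,
        Matrix.mul_assoc]
      congr 3
      ext i
      simp [hd]
    · rw [hs2, key, key]
      congr 3
      ext i
      exact mul_inv_mul_cancel (d i)
    · rw [hs2, key, key]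
      congr 3
      ext i
      simpa using mul_inv_mul_cancel ((d i)⁻¹)
    · rw [hs2, key, key]
      congr 3
      ext i
      exact mul_comm _ _
  have h4 : A * (C * (Aᴴ * A)) = A := by
    have : (A * (C * (Aᴴ * A)) - A)ᴴ * (A * (C * (Aᴴ * A)) - A) = 0 := by
      have e : (A * (C * (Aᴴ * A)) - A)ᴴ = ((Aᴴ * A) * C - 1) * Aᴴ := by
        simp only [conjTranspose_sub, conjTranspose_mul, conjTranspose_conjTranspose, hC,
          Matrix.sub_mul, Matrix.one_mul, Matrix.mul_assoc]
      rw [e, Matrix.mul_assoc, Matrix.mul_sub, ← Matrix.mul_assoc Aᴴ A, ← Matrix.mul_assoc (Aᴴ * A),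
        h1, sub_self, Matrix.mul_zero]
    exact sub_eq_zero.1 (conjTranspose_mul_self_eq_zero.1 this)
  refine ⟨C * Aᴴ, ?_, ?_, ?_, ?_⟩
  · simpa only [Matrix.mul_assoc] using h4
  · have := congrArg (· * Aᴴ) h2
    simpa only [Matrix.mul_assoc] using this
  · simp only [conjTranspose_mul, conjTranspose_conjTranspose, hC, Matrix.mul_assoc]
  · have : (C * (Aᴴ * A))ᴴ = C * (Aᴴ * A) := by
      rw [conjTranspose_mul, hC, hB.eq, h3]
    simpa only [Matrix.mul_assoc] using this

theorem IsMoorePenrose.unique {p q : ℕ} {A : Matrix (Fin p) (Fin q) ℂ}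
    {X Y : Matrix (Fin q) (Fin p) ℂ} (hX : IsMoorePenrose A X) (hY : IsMoorePenrose A Y) :
    X = Y := by
  have hl : A * X = A * Y := by
    calc A * X = (A * Y * A) * X := by rw [hY.mul_mul]
      _ = (A * Y)ᴴ * (A * X)ᴴ := by rw [hY.left_herm, hX.left_herm, Matrix.mul_assoc (A * Y)]
      _ = (A * X * A * Y)ᴴ := by rw [← conjTranspose_mul]; simp only [Matrix.mul_assoc]
      _ = A * Y := by rw [hX.mul_mul, hY.left_herm]
  have hr : X * A = Y * A := by
    calc X * A = X * (A * Y * A) := by rw [hY.mul_mul]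
      _ = (X * A)ᴴ * (Y * A)ᴴ := by rw [hY.right_herm, hX.right_herm]; simp only [Matrix.mul_assoc]
      _ = (Y * (A * X * A))ᴴ := by rw [← conjTranspose_mul]; simp only [Matrix.mul_assoc]
      _ = Y * A := by rw [hX.mul_mul, hY.right_herm]
  calc X = X * A * X := hX.mul_mul_inv.symm
    _ = Y * A * Y := by rw [hr, Matrix.mul_assoc, hl, ← Matrix.mul_assoc]
    _ = Y := hY.mul_mul_inv

/-- The Moore-Penrose inverse of a complex matrix: the unique solution of the Penrose equations. -/
def mpInv {p q : ℕ} (A : Matrix (Fin p) (Fin q) ℂ) : Matrix (Fin q) (Fin p) ℂ :=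
  Classical.choose (exists_isMoorePenrose A)

theorem mpInv_spec {p q : ℕ} (A : Matrix (Fin p) (Fin q) ℂ) : IsMoorePenrose A (mpInv A) :=
  Classical.choose_spec (exists_isMoorePenrose A)

/-! ### Classes of sequences

A finite or infinite sequence `(s_j)_{j=0}^κ` of complex matrices, `κ ∈ ℕ ∪ {∞}`, is given by a
function `s` on `ℕ` together with `κ : ℕ∞`; no definition below looks at `s j` for `j > κ`. -/

/-- The block Hankel matrix `H_n = (s_{j+k})_{j,k=0}^n`. -/
def blockH {q : ℕ} (s : ℕ → Matrix (Fin q) (Fin q) ℂ) (n : ℕ) :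
    Matrix (Fin (n + 1) × Fin q) (Fin (n + 1) × Fin q) ℂ :=
  Matrix.of fun x y => s ((x.1 : ℕ) + (y.1 : ℕ)) x.2 y.2

/-- The block Hankel matrix `K_n = (s_{j+k+1})_{j,k=0}^n`. -/
def blockK {q : ℕ} (s : ℕ → Matrix (Fin q) (Fin q) ℂ) (n : ℕ) :
    Matrix (Fin (n + 1) × Fin q) (Fin (n + 1) × Fin q) ℂ :=
  Matrix.of fun x y => s ((x.1 : ℕ) + (y.1 : ℕ) + 1) x.2 y.2

/-- `(s_j)_{j=0}^m` belongs to `K^≥_{q,m,α}`, `m` finite: for `m = 2n` the matrices `H_n` and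
(if `n ≥ 1`) `-α H_{n-1} + K_{n-1}`, for `m = 2n+1` the matrices `H_n` and `-α H_n + K_n`, are
nonnegative Hermitian. -/
def KNonnegFin {q : ℕ} (α : ℝ) (m : ℕ) (s : ℕ → Matrix (Fin q) (Fin q) ℂ) : Prop :=
  (∀ n : ℕ, m = 2 * n ∨ m = 2 * n + 1 → (blockH s n).PosSemidef) ∧
  (∀ n : ℕ, m = 2 * (n + 1) ∨ m = 2 * n + 1 →
    ((-(α : ℂ)) • blockH s n + blockK s n).PosSemidef)

/-- `(s_j)_{j=0}^m` belongs to `K^>_{q,m,α}`, `m` finite: the same with positive Hermitian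
matrices. -/
def KPosFin {q : ℕ} (α : ℝ) (m : ℕ) (s : ℕ → Matrix (Fin q) (Fin q) ℂ) : Prop :=
  (∀ n : ℕ, m = 2 * n ∨ m = 2 * n + 1 → (blockH s n).PosDef) ∧
  (∀ n : ℕ, m = 2 * (n + 1) ∨ m = 2 * n + 1 →
    ((-(α : ℂ)) • blockH s n + blockK s n).PosDef)

/-- `(s_j)_{j=0}^κ` belongs to `K^≥_{q,κ,α}`; for `κ = ∞` this means that all its finite
sections `(s_j)_{j=0}^m` belong to `K^≥_{q,m,α}`. -/
def KNonneg {q : ℕ} (α : ℝ) (κ : ℕ∞) (s : ℕ → Matrix (Fin q) (Fin q) ℂ) : Prop :=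
  (∀ m : ℕ, κ = (m : ℕ∞) → KNonnegFin α m s) ∧ (κ = ⊤ → ∀ m : ℕ, KNonnegFin α m s)

/-- `(s_j)_{j=0}^κ` belongs to `K^>_{q,κ,α}`; for `κ = ∞` this means that all its finite
sections `(s_j)_{j=0}^m` belong to `K^>_{q,m,α}`. -/
def KPos {q : ℕ} (α : ℝ) (κ : ℕ∞) (s : ℕ → Matrix (Fin q) (Fin q) ℂ) : Prop :=
  (∀ m : ℕ, κ = (m : ℕ∞) → KPosFin α m s) ∧ (κ = ⊤ → ∀ m : ℕ, KPosFin α m s)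

/-! ### The Schur-type algorithm -/

/-- The reciprocal sequence: `r_0 = s_0†`, `r_j = -s_0† ∑_{l=0}^{j-1} s_{j-l} r_l` for `j ≥ 1`. -/
def recip {p q : ℕ} (s : ℕ → Matrix (Fin p) (Fin q) ℂ) : ℕ → Matrix (Fin q) (Fin p) ℂ
  | 0 => mpInv (s 0)
  | j + 1 => -(mpInv (s 0) * ∑ l : Fin (j + 1), s (j + 1 - (l : ℕ)) * recip s (l : ℕ))
  decreasing_by exact l.isLt

/-- The `[+,α]`-transform `-α s_{j-1} + s_j`, where `s_{-1} = 0`. -/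
def plusTransform {p q : ℕ} (α : ℂ) (s : ℕ → Matrix (Fin p) (Fin q) ℂ) :
    ℕ → Matrix (Fin p) (Fin q) ℂ
  | 0 => s 0
  | j + 1 => (-α) • s j + s (j + 1)

/-- The first `α`-Schur transform `(s_j^{[1,α]})_{j=0}^{κ-1}` of `(s_j)_{j=0}^κ`:
`s_j^{[1,α]} = -s_0 r_{j+1} s_0`, where `r` is the reciprocal sequence of the
`[+,α]`-transform. Its `j`-th entry depends on `s_0, …, s_{j+1}` only. -/
def schurTransform {p q : ℕ} (α : ℂ) (s : ℕ → Matrix (Fin p) (Fin q) ℂ) (j : ℕ) :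
    Matrix (Fin p) (Fin q) ℂ :=
  s 0 * (-(recip (plusTransform α s) (j + 1))) * s 0

/-- The `k`-th `α`-Schur transform `(s_j^{[k,α]})_{j=0}^{κ-k}`. -/
def schurIter {p q : ℕ} (α : ℂ) (s : ℕ → Matrix (Fin p) (Fin q) ℂ) :
    ℕ → ℕ → Matrix (Fin p) (Fin q) ℂ
  | 0 => s
  | k + 1 => schurTransform α (schurIter α s k)

/-- `P_j^{[k]} = s_j^{[k,α]} - s_0^{[k,α]} (s_0^{[k,α]})† s_j^{[k,α]} (s_0^{[k,α]})† s_0^{[k,α]}`. -/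
def corrP {p q : ℕ} (α : ℂ) (s : ℕ → Matrix (Fin p) (Fin q) ℂ) (j k : ℕ) :
    Matrix (Fin p) (Fin q) ℂ :=
  schurIter α s k j - schurIter α s k 0 * mpInv (schurIter α s k 0) * schurIter α s k j *
    mpInv (schurIter α s k 0) * schurIter α s k 0

/-- `Z_l^{[m]} = ∑_{k=0}^{m-1} P_{l-k}^{[k]}` (used for `m ≤ l`; it is `0` for `m = 0`). -/
def corrZ {p q : ℕ} (α : ℂ) (s : ℕ → Matrix (Fin p) (Fin q) ℂ) (l m : ℕ) :
    Matrix (Fin p) (Fin q) ℂ :=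
  ∑ k ∈ Finset.range m, corrP α s (l - k) k

end StieltjesSchur

end

open scoped ComplexOrder

noncomputable section

namespace StieltjesSchur

open Matrix Finset


/-! One Schur step removes one entry and exchanges the two Hankel conditions. Let `S` be the power
series of the sequence, with `s 0` invertible, let `U = (1 - αX) S` and `R = U⁻¹`, and let `t_j =
-s_0 r_{j+1} s_0` be the transform.

For mutually inverse `F`, `G`, multiplying a Hankel matrix of `G` by the Toeplitz matrices of `F`
gives a Hankel matrix of `-F`, because the higher coefficients of `F * G` vanish. These products are
congruences when the coefficients are Hermitian. Applied to `R`, `U` and scaled by `s 0`, this makes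
`-α H_n + K_n` of `s` congruent to `H_n` of `t`. Applied to `W = (1 - αX) R = S⁻¹` and `S`, it makes
`H_{n+1}` of `s` congruent to the direct sum of `s_0` and `-α H_n + K_n` of `t`.

So, when `s 0` is positive, `t` inherits nonnegativity, and `t` is positive exactly when `s` is
(`KNonnegFin.kPosFin_schurTransform_iff`). Induction on the length gives the equivalence, since a
nonnegative Hermitian matrix with nonzero determinant is positive. The corrections vanish because
`mpInv` of an invertible matrix is its inverse. -/

/-! ### Toeplitz and Hankel matrices over a ring -/

section Ring

variable {M : Type*} [Ring M]

/-- The lower triangular Toeplitz matrix of a power series. -/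
def lowerToeplitz (n : ℕ) (F : PowerSeries M) : Matrix (Fin (n + 1)) (Fin (n + 1)) M :=
  Matrix.of fun i j => if (j : ℕ) ≤ i then PowerSeries.coeff ((i : ℕ) - j) F else 0

/-- The upper triangular Toeplitz matrix of a power series. -/
def upperToeplitz (n : ℕ) (F : PowerSeries M) : Matrix (Fin (n + 1)) (Fin (n + 1)) M :=
  Matrix.of fun i j => if (i : ℕ) ≤ j then PowerSeries.coeff ((j : ℕ) - i) F else 0

/-- The Hankel matrix of a sequence. -/
def hankel (n : ℕ) (a : ℕ → M) : Matrix (Fin (n + 1)) (Fin (n + 1)) M :=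
  Matrix.of fun i j => a ((i : ℕ) + j)

theorem sum_fin_le_eq_sum_antidiagonal {n i : ℕ} (hi : i ≤ n) (φ : ℕ → ℕ → M) :
    ∑ a : Fin (n + 1), (if (a : ℕ) ≤ i then φ (i - a) a else 0) =
      ∑ p ∈ antidiagonal i, φ p.1 p.2 := by
  rw [Fin.sum_univ_eq_sum_range (fun a => if a ≤ i then φ (i - a) a else 0) (n + 1),
    ← sum_filter, ← Finset.Nat.sum_antidiagonal_swap]
  rw [show (range (n + 1)).filter (· ≤ i) = range i.succ by ext; simp; omega]
  exact (Finset.Nat.sum_antidiagonal_eq_sum_range_succ (fun a b => φ b a) i).symm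

theorem lowerToeplitz_mul_apply (n : ℕ) (F : PowerSeries M)
    (A : Matrix (Fin (n + 1)) (Fin (n + 1)) M) (f : ℕ → ℕ → M) (hf : ∀ i j, A i j = f i j)
    (i j : Fin (n + 1)) :
    (lowerToeplitz n F * A) i j =
      ∑ p ∈ antidiagonal (i : ℕ), PowerSeries.coeff p.1 F * f p.2 j := by
  rw [← sum_fin_le_eq_sum_antidiagonal (Nat.le_of_lt_succ i.2)
    (fun a b => PowerSeries.coeff a F * f b j), Matrix.mul_apply]
  simp [lowerToeplitz, hf]

theorem mul_upperToeplitz_apply (n : ℕ) (F : PowerSeries M)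
    (A : Matrix (Fin (n + 1)) (Fin (n + 1)) M) (f : ℕ → ℕ → M) (hf : ∀ i j, A i j = f i j)
    (i j : Fin (n + 1)) :
    (A * upperToeplitz n F) i j =
      ∑ p ∈ antidiagonal (j : ℕ), f i p.1 * PowerSeries.coeff p.2 F := by
  rw [← Finset.Nat.sum_antidiagonal_swap]
  simp only [Prod.fst_swap, Prod.snd_swap]
  rw [← sum_fin_le_eq_sum_antidiagonal (Nat.le_of_lt_succ j.2)
    (fun a b => f i b * PowerSeries.coeff a F), Matrix.mul_apply]
  simp [upperToeplitz, hf]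

theorem upperToeplitz_mul (n : ℕ) (F G : PowerSeries M) (h : F * G = 1) :
    upperToeplitz n F * upperToeplitz n G = 1 := by
  ext i j
  rw [mul_upperToeplitz_apply n G (upperToeplitz n F)
    (fun i j => if i ≤ j then PowerSeries.coeff (j - i) F else 0) (fun _ _ => rfl)]
  rcases le_or_gt (i : ℕ) j with hij | hij
  · obtain ⟨d, hd⟩ := Nat.exists_eq_add_of_le hij
    have h1 := congrArg (PowerSeries.coeff d) h
    rw [PowerSeries.coeff_mul, Finset.Nat.sum_antidiagonal_eq_sum_range_succ
      (fun a b => PowerSeries.coeff a F * PowerSeries.coeff b G)] at h1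
    rw [Finset.Nat.sum_antidiagonal_eq_sum_range_succ
      (fun a b => (if (i : ℕ) ≤ a then PowerSeries.coeff (a - i) F else 0) *
        PowerSeries.coeff b G), hd, Nat.succ_eq_add_one, add_assoc, Finset.sum_range_add,
      Finset.sum_eq_zero, zero_add]
    · simp only [le_add_iff_nonneg_right, zero_le, if_true, add_tsub_cancel_left,
        Nat.add_sub_add_left]
      rw [h1, PowerSeries.coeff_one, Matrix.one_apply]
      simp [Fin.ext_iff, hd]
    · intro x hx
      simp [not_le.2 (mem_range.1 hx)]
  · rw [Matrix.one_apply_ne (by rintro rfl; omega)]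
    refine Finset.sum_eq_zero fun p hp => ?_
    have := mem_antidiagonal.1 hp
    rw [if_neg (by omega), zero_mul]

theorem lowerToeplitz_mul (n : ℕ) (F G : PowerSeries M) (h : F * G = 1) :
    lowerToeplitz n F * lowerToeplitz n G = 1 := by
  ext i j
  rw [lowerToeplitz_mul_apply n F (lowerToeplitz n G)
    (fun i j => if j ≤ i then PowerSeries.coeff (i - j) G else 0) (fun _ _ => rfl),
    ← Finset.Nat.sum_antidiagonal_swap]
  simp only [Prod.fst_swap, Prod.snd_swap]
  rcases le_or_gt (j : ℕ) i with hij | hij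
  · obtain ⟨d, hd⟩ := Nat.exists_eq_add_of_le hij
    have h1 := congrArg (PowerSeries.coeff d) h
    rw [PowerSeries.coeff_mul, ← Finset.Nat.sum_antidiagonal_swap] at h1
    simp only [Prod.fst_swap, Prod.snd_swap] at h1
    rw [Finset.Nat.sum_antidiagonal_eq_sum_range_succ
      (fun a b => PowerSeries.coeff b F * PowerSeries.coeff a G)] at h1
    rw [Finset.Nat.sum_antidiagonal_eq_sum_range_succ
      (fun a b => PowerSeries.coeff b F *
        (if (j : ℕ) ≤ a then PowerSeries.coeff (a - j) G else 0)), hd, Nat.succ_eq_add_one,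
      add_assoc, Finset.sum_range_add, Finset.sum_eq_zero, zero_add]
    · simp only [le_add_iff_nonneg_right, zero_le, if_true, add_tsub_cancel_left,
        Nat.add_sub_add_left]
      rw [h1, PowerSeries.coeff_one, Matrix.one_apply]
      simp [Fin.ext_iff, hd]
    · intro x hx
      simp [not_le.2 (mem_range.1 hx)]
  · rw [Matrix.one_apply_ne (by rintro rfl; omega)]
    refine Finset.sum_eq_zero fun p hp => ?_
    have := mem_antidiagonal.1 hp
    rw [if_neg (by omega), mul_zero]

theorem sum_antidiagonal_add_succ (f g : ℕ → M) (i b : ℕ) :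
    ∑ p ∈ antidiagonal (i + b + 1), f p.1 * g p.2 =
      ∑ p ∈ antidiagonal i, f p.1 * g (p.2 + b + 1) +
        ∑ p ∈ antidiagonal b, f (p.1 + i + 1) * g p.2 := by
  rw [Finset.Nat.sum_antidiagonal_eq_sum_range_succ (fun x y => f x * g y),
    Finset.Nat.sum_antidiagonal_eq_sum_range_succ (fun x y => f x * g (y + b + 1)),
    Finset.Nat.sum_antidiagonal_eq_sum_range_succ (fun x y => f (x + i + 1) * g y),
    show (i + b + 1).succ = i.succ + b.succ by omega, Finset.sum_range_add]
  congr 1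
  · refine Finset.sum_congr rfl fun x hx => ?_
    have := mem_range.1 hx
    congr 2
    omega
  · refine Finset.sum_congr rfl fun x hx => ?_
    congr 2 <;> omega

/-- The coefficient of `F * G` at `i + b + 1` is zero; its terms are split according to whether the
index on `F` is at most `i`. -/
theorem sum_antidiagonal_shift_eq_neg {F G : PowerSeries M} (h : F * G = 1) (i b : ℕ) :
    ∑ p ∈ antidiagonal i, PowerSeries.coeff p.1 F * PowerSeries.coeff (p.2 + b + 1) G =
      -∑ p ∈ antidiagonal b, PowerSeries.coeff (p.1 + i + 1) F * PowerSeries.coeff p.2 G := by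
  have h1 := congrArg (PowerSeries.coeff (i + b + 1)) h
  rw [PowerSeries.coeff_mul, PowerSeries.coeff_one, if_neg (by omega),
    sum_antidiagonal_add_succ (fun k => PowerSeries.coeff k F) (fun k => PowerSeries.coeff k G)]
    at h1
  exact eq_neg_of_add_eq_zero_left h1

/-- Congruence of the shifted Hankel matrices of a power series and of its inverse. -/
theorem lowerToeplitz_mul_hankel_succ_mul (n : ℕ) {F G : PowerSeries M} (h : F * G = 1)
    (h' : G * F = 1) :
    lowerToeplitz n F * hankel n (fun j => PowerSeries.coeff (j + 1) G) * upperToeplitz n F =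
      hankel n (fun j => -PowerSeries.coeff (j + 1) F) := by
  -- Since `upperToeplitz n G` inverts `upperToeplitz n F`, it suffices to compare one-sided
  -- products, whose entries are the two halves of a vanishing coefficient of `F * G`.
  have key : lowerToeplitz n F * hankel n (fun j => PowerSeries.coeff (j + 1) G) =
      hankel n (fun j => -PowerSeries.coeff (j + 1) F) * upperToeplitz n G := by
    ext i j
    rw [lowerToeplitz_mul_apply n F (hankel n fun j => PowerSeries.coeff (j + 1) G)
      (fun a b => PowerSeries.coeff (a + b + 1) G)
      (fun _ _ => rfl), mul_upperToeplitz_apply n G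
      (hankel n fun j => -PowerSeries.coeff (j + 1) F) (fun a b => -PowerSeries.coeff (a + b + 1) F) (fun _ _ => rfl),
      sum_antidiagonal_shift_eq_neg h, ← Finset.sum_neg_distrib]
    refine Finset.sum_congr rfl fun p _ => ?_
    rw [neg_mul, add_comm p.1]
  rw [key, Matrix.mul_assoc, upperToeplitz_mul n G F h', Matrix.mul_one]

/-- The block diagonal matrix with the entry `c` followed by a Hankel block. -/
def borderedHankel (n : ℕ) (c : M) (a : ℕ → M) : Matrix (Fin (n + 1)) (Fin (n + 1)) M :=
  Matrix.of fun i j => if (i : ℕ) = 0 then (if (j : ℕ) = 0 then c else 0)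
    else if (j : ℕ) = 0 then 0 else a ((i : ℕ) + j)

/-- Congruence of the Hankel matrix of a power series and a block diagonal matrix built from
its inverse. -/
theorem lowerToeplitz_mul_hankel_mul (n : ℕ) {F G : PowerSeries M} (h : F * G = 1)
    (h' : G * F = 1) :
    lowerToeplitz n F * hankel n (fun j => PowerSeries.coeff j G) * upperToeplitz n F =
      borderedHankel n (PowerSeries.coeff 0 F) (fun j => -PowerSeries.coeff j F) := by
  have key : lowerToeplitz n F * hankel n (fun j => PowerSeries.coeff j G) =
      borderedHankel n (PowerSeries.coeff 0 F) (fun j => -PowerSeries.coeff j F) *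
        upperToeplitz n G := by
    ext i j
    rw [lowerToeplitz_mul_apply n F (hankel n fun j => PowerSeries.coeff j G)
      (fun a b => PowerSeries.coeff (a + b) G)
      (fun _ _ => rfl), mul_upperToeplitz_apply n G
      (borderedHankel n (PowerSeries.coeff 0 F) fun j => -PowerSeries.coeff j F)
      (fun i j => if i = 0 then (if j = 0 then PowerSeries.coeff 0 F else 0)
        else if j = 0 then 0 else -PowerSeries.coeff (i + j) F) (fun _ _ => rfl)]
    generalize (i : ℕ) = i
    generalize (j : ℕ) = j
    rcases i with _ | i
    · rcases j with _ | j
      · simp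
      · rw [Finset.Nat.antidiagonal_succ (n := j)]
        simp
    · rcases j with _ | j
      -- In column 0 the left side is a full coefficient of `F * G` of positive degree, hence zero.
      -- In the other columns the zero border removes the first term on the right and shifts the
      -- index by one.
      · have h1 := congrArg (PowerSeries.coeff (i + 1)) h
        rw [PowerSeries.coeff_mul, PowerSeries.coeff_one, if_neg (by omega)] at h1
        simpa using h1
      · rw [Finset.Nat.antidiagonal_succ (n := j)]
        have h1 := sum_antidiagonal_shift_eq_neg h (i + 1) j
        simp only [← add_assoc]
        rw [h1]
        simp [← Finset.sum_neg_distrib]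
        refine Finset.sum_congr rfl fun p _ => ?_
        rw [show p.1 + (i + 1) + 1 = i + 1 + (p.1 + 1) by omega]
  rw [key, Matrix.mul_assoc, upperToeplitz_mul n G F h', Matrix.mul_one]

/-! ### Hermitian coefficients and adjoints of Toeplitz matrices -/

variable [StarRing M]

/-- Starring `G * F = 1` shows that the coefficientwise star of `F` is a left inverse of `G` up to
degree `n`, and it therefore agrees with `F` there. The bound is essential: entries beyond the end
of a finite sequence are arbitrary. -/
theorem coeff_star_of_mul_eq_one {F G : PowerSeries M} (h' : G * F = 1) {n : ℕ}
    (hG : ∀ j ≤ n, star (PowerSeries.coeff j G) = PowerSeries.coeff j G) :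
    ∀ j ≤ n, star (PowerSeries.coeff j F) = PowerSeries.coeff j F := by
  set F' : PowerSeries M := PowerSeries.mk fun j => star (PowerSeries.coeff j F) with hF'
  have h1 : ∀ k ≤ n, PowerSeries.coeff k (F' * G - 1) = 0 := by
    intro k hk
    have h2 := congrArg (fun x => star (PowerSeries.coeff k x)) h'
    simp only [PowerSeries.coeff_mul, star_sum, star_mul, PowerSeries.coeff_one] at h2
    rw [map_sub, sub_eq_zero, PowerSeries.coeff_mul, PowerSeries.coeff_one]
    rw [← Finset.Nat.sum_antidiagonal_swap] at h2
    refine Eq.trans (Finset.sum_congr rfl fun p hp => ?_) (h2.trans (by split_ifs <;> simp))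
    have := mem_antidiagonal.1 hp
    simp [hF', hG p.2 (by omega)]
  intro j hj
  have h2 : PowerSeries.coeff j ((F' * G - 1) * F) = 0 := by
    rw [PowerSeries.coeff_mul]
    refine Finset.sum_eq_zero fun p hp => ?_
    have := mem_antidiagonal.1 hp
    rw [h1 p.1 (by omega), zero_mul]
  rw [sub_mul, mul_assoc, h', mul_one, one_mul, map_sub, sub_eq_zero] at h2
  simpa [hF'] using h2

theorem lowerToeplitz_conjTranspose (n : ℕ) {F : PowerSeries M}
    (hF : ∀ j ≤ n, star (PowerSeries.coeff j F) = PowerSeries.coeff j F) :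
    (lowerToeplitz n F)ᴴ = upperToeplitz n F := by
  ext i j
  simp only [lowerToeplitz, upperToeplitz, Matrix.conjTranspose_apply, Matrix.of_apply]
  split_ifs
  · exact hF _ (by omega)
  · simp

end Ring


/-! ### Congruence of block matrices -/

/-- `A` and `B` are nonnegative (positive) Hermitian simultaneously. -/
def SamePositivity {m n : Type*} (A : Matrix m m ℂ) (B : Matrix n n ℂ) : Prop :=
  (A.PosSemidef ↔ B.PosSemidef) ∧ (A.PosDef ↔ B.PosDef)

/-- The complex matrix with the given blocks. -/
abbrev flat {q n : ℕ} (X : Matrix (Fin (n + 1)) (Fin (n + 1)) (Matrix (Fin q) (Fin q) ℂ)) :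
    Matrix (Fin (n + 1) × Fin q) (Fin (n + 1) × Fin q) ℂ :=
  Matrix.compRingEquiv (Fin (n + 1)) (Fin q) ℂ X

theorem flat_conjTranspose {q n : ℕ}
    (X : Matrix (Fin (n + 1)) (Fin (n + 1)) (Matrix (Fin q) (Fin q) ℂ)) :
    flat Xᴴ = (flat X)ᴴ := by
  ext i j
  rfl

/-- Flattening blocks is a ring isomorphism compatible with adjoints, so congruences can be computed
over the noncommutative ring of blocks. -/
theorem samePositivity_flat_congruence {q n : ℕ}
    {B : Matrix (Fin (n + 1)) (Fin (n + 1)) (Matrix (Fin q) (Fin q) ℂ)} (hB : IsUnit B)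
    (X : Matrix (Fin (n + 1)) (Fin (n + 1)) (Matrix (Fin q) (Fin q) ℂ)) :
    SamePositivity (flat (B * X * Bᴴ)) (flat X) := by
  have hU : IsUnit (flat B) := hB.map (Matrix.compRingEquiv (Fin (n + 1)) (Fin q) ℂ)
  have e : flat (B * X * Bᴴ) = flat B * flat X * star (flat B) := by
    rw [star_eq_conjTranspose, ← flat_conjTranspose]
    simp only [flat, map_mul]
  unfold SamePositivity
  rw [e]
  exact ⟨hU.posSemidef_star_right_conjugate_iff, hU.posDef_star_right_conjugate_iff⟩

theorem isUnit_diagonal_const {q n : ℕ} {c : Matrix (Fin q) (Fin q) ℂ} (hc : IsUnit c) :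
    IsUnit (Matrix.diagonal fun _ : Fin (n + 1) => c) :=
  hc.map (Matrix.scalar (Fin (n + 1)))

/-- Congruence by a scaled lower triangular Toeplitz matrix with Hermitian entries. -/
theorem samePositivity_toeplitz {q n : ℕ} {F G : PowerSeries (Matrix (Fin q) (Fin q) ℂ)}
    (h : F * G = 1) (h' : G * F = 1)
    (hG : ∀ j ≤ n, star (PowerSeries.coeff j G) = PowerSeries.coeff j G)
    {c : Matrix (Fin q) (Fin q) ℂ} (hc : IsUnit c) (hc' : star c = c)
    {X Y Z : Matrix (Fin (n + 1)) (Fin (n + 1)) (Matrix (Fin q) (Fin q) ℂ)}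
    (hY : lowerToeplitz n F * X * upperToeplitz n F = Y)
    (hZ : ∀ i j, c * Y i j * c = Z i j) :
    SamePositivity (flat X) (flat Z) := by
  have hL : IsUnit (lowerToeplitz n F) :=
    ⟨⟨_, _, lowerToeplitz_mul n F G h, lowerToeplitz_mul n G F h'⟩, rfl⟩
  have hs := samePositivity_flat_congruence ((isUnit_diagonal_const (n := n) hc).mul hL) X
  have hD : (Matrix.diagonal fun _ : Fin (n + 1) => c)ᴴ = Matrix.diagonal fun _ => c := by
    rw [Matrix.diagonal_conjTranspose]
    congr 1
    ext1 _
    exact hc'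
  have e : (Matrix.diagonal fun _ => c) * lowerToeplitz n F * X *
      ((Matrix.diagonal fun _ => c) * lowerToeplitz n F)ᴴ = Z := by
    rw [conjTranspose_mul, hD, lowerToeplitz_conjTranspose n (coeff_star_of_mul_eq_one h' hG)]
    calc _ = (Matrix.diagonal fun _ => c) *
          (lowerToeplitz n F * X * upperToeplitz n F) * (Matrix.diagonal fun _ => c) := by
          simp only [Matrix.mul_assoc]
      _ = Z := by
          rw [hY]
          ext1 i j
          rw [Matrix.mul_diagonal, Matrix.diagonal_mul, hZ]
  rw [e] at hs
  exact ⟨hs.1.symm, hs.2.symm⟩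

theorem blockH_eq_flat {q : ℕ} (s : ℕ → Matrix (Fin q) (Fin q) ℂ) (n : ℕ) :
    blockH s n = flat (hankel n s) := rfl

theorem smul_blockH_add_blockK_eq_flat {q : ℕ} (α : ℂ) (s : ℕ → Matrix (Fin q) (Fin q) ℂ)
    (n : ℕ) :
    (-α) • blockH s n + blockK s n = flat (hankel n fun j => plusTransform α s (j + 1)) := rfl

/-! ### Block diagonal matrices -/

/-- The Schur complement of `A` is `D` itself, which settles semidefiniteness; definiteness then
follows by comparing determinants. -/
theorem samePositivity_fromBlocks {m n : Type*} [Fintype m] [DecidableEq m] [Fintype n]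
    [DecidableEq n] {A : Matrix m m ℂ} (hA : A.PosDef) (D : Matrix n n ℂ) :
    SamePositivity (Matrix.fromBlocks A 0 0 D) D := by
  have := hA.isUnit.invertible
  have h1 : (Matrix.fromBlocks A 0 0 D).PosSemidef ↔ D.PosSemidef := by
    simpa using Matrix.PosDef.fromBlocks₁₁ (0 : Matrix m n ℂ) D hA
  have hdet : (Matrix.fromBlocks A 0 0 D).det ≠ 0 ↔ D.det ≠ 0 := by
    rw [Matrix.det_fromBlocks_zero₂₁, mul_ne_zero_iff]
    exact and_iff_right hA.det_pos.ne'
  refine ⟨h1, fun h => ?_, fun h => ?_⟩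
  · exact (h1.1 h.posSemidef).posDef_iff_det_ne_zero.2 (hdet.1 h.det_pos.ne')
  · exact (h1.2 h.posSemidef).posDef_iff_det_ne_zero.2 (hdet.2 h.det_pos.ne')

theorem samePositivity_submatrix_equiv {m n : Type*} [Fintype m] [DecidableEq m] [Fintype n]
    [DecidableEq n] (A : Matrix n n ℂ) (e : m ≃ n) :
    SamePositivity (A.submatrix e e) A := by
  have h1 := Matrix.posSemidef_submatrix_equiv (M := A) e
  have hdet := Matrix.det_submatrix_equiv_self e A
  refine ⟨h1, fun h => ?_, fun h => ?_⟩
  · exact (h1.1 h.posSemidef).posDef_iff_det_ne_zero.2 (hdet ▸ h.det_pos.ne')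
  · exact (h1.2 h.posSemidef).posDef_iff_det_ne_zero.2 (hdet.symm ▸ h.det_pos.ne')

theorem samePositivity_borderedHankel {q : ℕ} {c : Matrix (Fin q) (Fin q) ℂ} (hc : c.PosDef)
    (n : ℕ) (a : ℕ → Matrix (Fin q) (Fin q) ℂ) :
    SamePositivity (flat (borderedHankel (n + 1) c a)) (flat (hankel n fun j => a (j + 2))) := by
  -- Splits off block index 0; the remaining block indices each drop by one, which turns `a (i + j)`
  -- into `a (i + j + 2)`.
  let f : Fin q ⊕ Fin (n + 1) × Fin q → Fin (n + 1 + 1) × Fin q :=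
    Sum.elim (fun x => (0, x)) fun y => (y.1.succ, y.2)
  have hf : Function.Bijective f := by
    constructor
    · rintro (x | ⟨x, x'⟩) (y | ⟨y, y'⟩) h
      · exact congrArg Sum.inl (Prod.ext_iff.1 h).2
      · exact absurd (Prod.ext_iff.1 h).1.symm (Fin.succ_ne_zero y)
      · exact absurd (Prod.ext_iff.1 h).1 (Fin.succ_ne_zero x)
      · exact congrArg Sum.inr
          (Prod.ext (Fin.succ_injective _ (Prod.ext_iff.1 h).1) (Prod.ext_iff.1 h).2)
    · rintro ⟨x, y⟩
      refine Fin.cases ⟨Sum.inl y, rfl⟩ (fun i => ⟨Sum.inr (i, y), rfl⟩) x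
  let e := Equiv.ofBijective f hf
  have h1 : (flat (borderedHankel (n + 1) c a)).submatrix e e =
      Matrix.fromBlocks c 0 0 (flat (hankel n fun j => a (j + 2))) := by
    ext (x | ⟨x, x'⟩) (y | ⟨y, y'⟩)
    · change borderedHankel (n + 1) c a 0 0 x y = _
      simp [borderedHankel]
    · change borderedHankel (n + 1) c a 0 y.succ x y' = _
      simp [borderedHankel]
    · change borderedHankel (n + 1) c a x.succ 0 x' y = _
      simp [borderedHankel]
    · change borderedHankel (n + 1) c a x.succ y.succ x' y' = a (x + y + 2) x' y'
      simp only [borderedHankel, Matrix.of_apply, Fin.val_succ, Nat.add_one_ne_zero, if_false]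
      rw [show (x : ℕ) + 1 + (y + 1) = x + y + 2 by omega]
  have h2 := samePositivity_submatrix_equiv (flat (borderedHankel (n + 1) c a)) e
  rw [h1] at h2
  have h3 := samePositivity_fromBlocks hc (flat (hankel n fun j => a (j + 2)))
  exact ⟨h2.1.symm.trans h3.1, h2.2.symm.trans h3.2⟩

/-! ### The reciprocal sequence as an inverse power series -/

theorem mul_mpInv {q : ℕ} {A : Matrix (Fin q) (Fin q) ℂ} (hA : IsUnit A) : A * mpInv A = 1 :=
  hA.mul_right_cancel (by rw [(mpInv_spec A).mul_mul, one_mul])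

theorem mpInv_mul {q : ℕ} {A : Matrix (Fin q) (Fin q) ℂ} (hA : IsUnit A) : mpInv A * A = 1 :=
  hA.mul_left_cancel (by rw [← mul_assoc, (mpInv_spec A).mul_mul, mul_one])

/-- The recursion defining `recip` is the vanishing of the coefficient of degree `j + 1`, solved for
its last unknown. -/
theorem mk_mul_mk_recip {q : ℕ} {u : ℕ → Matrix (Fin q) (Fin q) ℂ} (hu : IsUnit (u 0)) :
    PowerSeries.mk u * PowerSeries.mk (recip u) = 1 := by
  ext1 k
  rw [PowerSeries.coeff_mul, PowerSeries.coeff_one]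
  rcases k with _ | j
  · simp [recip, mul_mpInv hu]
  · rw [Finset.Nat.antidiagonal_succ (n := j), Finset.sum_cons, Finset.sum_map,
      if_neg (by omega), ← Finset.Nat.sum_antidiagonal_swap,
      Finset.Nat.sum_antidiagonal_eq_sum_range_succ_mk]
    simp only [PowerSeries.coeff_mk, recip]
    rw [mul_neg, ← mul_assoc, mul_mpInv hu, one_mul,
      Fin.sum_univ_eq_sum_range (fun l => u (j + 1 - l) * recip u l) (j + 1), neg_add_eq_zero]
    refine Finset.sum_congr rfl fun l hl => ?_
    have := mem_range.1 hl
    simp [Nat.succ_sub (show l ≤ j by omega)]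

/-- The reciprocal series has `mk u` as a left inverse and its own reciprocal as a right inverse, so
these coincide. -/
theorem mk_recip_mul_mk {q : ℕ} {u : ℕ → Matrix (Fin q) (Fin q) ℂ} (hu : IsUnit (u 0)) :
    PowerSeries.mk (recip u) * PowerSeries.mk u = 1 := by
  have h0 : IsUnit (recip u 0) := by
    rw [recip]
    exact ⟨⟨_, _, mpInv_mul hu, mul_mpInv hu⟩, rfl⟩
  have h1 := mk_mul_mk_recip h0
  rwa [← left_inv_eq_right_inv (mk_mul_mk_recip hu) h1] at h1


/-! ### One step of the Schur algorithm -/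

section Step

variable {q : ℕ}

theorem mk_plusTransform (α : ℂ) (s : ℕ → Matrix (Fin q) (Fin q) ℂ) :
    PowerSeries.mk (plusTransform α s) =
      PowerSeries.mk s - α • (PowerSeries.X * PowerSeries.mk s) := by
  ext1 k
  rcases k with _ | k
  · simp [plusTransform]
  · simp [plusTransform, PowerSeries.coeff_succ_X_mul, sub_eq_add_neg, add_comm]

theorem schurTransform_eq (α : ℂ) (s : ℕ → Matrix (Fin q) (Fin q) ℂ) (j : ℕ) :
    s 0 * -PowerSeries.coeff (j + 1) (PowerSeries.mk (recip (plusTransform α s))) * s 0 =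
      schurTransform α s j := by
  rw [PowerSeries.coeff_mk, schurTransform]

theorem plusTransform_star {α : ℝ} {s : ℕ → Matrix (Fin q) (Fin q) ℂ} {n : ℕ}
    (hs : ∀ j ≤ n, star (s j) = s j) :
    ∀ j ≤ n, star (plusTransform (α : ℂ) s j) = plusTransform (α : ℂ) s j := by
  rintro (_ | j) hj
  · exact hs 0 hj
  · simp [plusTransform, star_smul, hs j (by omega), hs (j + 1) hj]

/-- `-α H_n + K_n` of a sequence is congruent to `H_n` of its Schur transform. -/
theorem samePositivity_plusTransform_schurTransform {α : ℝ} {s : ℕ → Matrix (Fin q) (Fin q) ℂ}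
    (h0 : IsUnit (s 0)) {n : ℕ} (hs : ∀ j ≤ n, star (s j) = s j) :
    SamePositivity ((-(α : ℂ)) • blockH s n + blockK s n)
      (blockH (schurTransform (α : ℂ) s) n) := by
  rw [smul_blockH_add_blockK_eq_flat, blockH_eq_flat]
  have hu : IsUnit (plusTransform (α : ℂ) s 0) := h0
  set U := PowerSeries.mk (plusTransform (α : ℂ) s) with hU
  set R := PowerSeries.mk (recip (plusTransform (α : ℂ) s)) with hR
  have hRU : R * U = 1 := mk_recip_mul_mk hu
  have hUR : U * R = 1 := mk_mul_mk_recip hu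
  have hU' : ∀ j, PowerSeries.coeff j U = plusTransform (α : ℂ) s j := fun j => by simp [hU]
  have key := lowerToeplitz_mul_hankel_succ_mul n hRU hUR
  simp only [hU'] at key
  -- The Hankel matrix reaches index `2n + 1`, but the Toeplitz factors only see coefficients up to
  -- `n`, so Hermitian entries up to `n` are enough.
  refine samePositivity_toeplitz hRU hUR
    (fun j hj => by rw [hU']; exact plusTransform_star hs j hj) h0 (hs 0 (Nat.zero_le n)) key
    fun i j => ?_
  simp only [hankel, Matrix.of_apply]
  exact schurTransform_eq _ s _

/-- `H_{n+1}` of a sequence is congruent to the block diagonal matrix built from `s_0` and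
`-α H_n + K_n` of its Schur transform. -/
theorem samePositivity_blockH_schurTransform {α : ℝ} {s : ℕ → Matrix (Fin q) (Fin q) ℂ}
    (h0 : (s 0).PosDef) {n : ℕ} (hs : ∀ j ≤ n + 1, star (s j) = s j) :
    SamePositivity (blockH s (n + 1)) ((-(α : ℂ)) • blockH (schurTransform (α : ℂ) s) n +
      blockK (schurTransform (α : ℂ) s) n) := by
  rw [smul_blockH_add_blockK_eq_flat, blockH_eq_flat]
  have hu : IsUnit (plusTransform (α : ℂ) s 0) := h0.isUnit
  set R := PowerSeries.mk (recip (plusTransform (α : ℂ) s)) with hR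
  set W := R - (α : ℂ) • (PowerSeries.X * R) with hW
  set S := PowerSeries.mk s with hS
  have hRU : R * (S - (α : ℂ) • (PowerSeries.X * S)) = 1 := by
    rw [← mk_plusTransform]; exact mk_recip_mul_mk hu
  have hUR : (S - (α : ℂ) • (PowerSeries.X * S)) * R = 1 := by
    rw [← mk_plusTransform]; exact mk_mul_mk_recip hu
  -- The factor `1 - αX` is central, so it can be moved from `S` to `R`.
  have hWS : W * S = 1 := by
    rw [← hRU, hW, sub_mul, mul_sub, smul_mul_assoc, mul_smul_comm, ← mul_assoc R,
      ← (PowerSeries.commute_X R).eq]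
  have hSW : S * W = 1 := by
    rw [← hUR, hW, sub_mul, mul_sub, smul_mul_assoc, mul_smul_comm, ← mul_assoc S,
      ← (PowerSeries.commute_X S).eq]
  have h1 := samePositivity_toeplitz (n := n + 1) (c := s 0)
    (X := hankel (n + 1) s) (Z := borderedHankel (n + 1) (s 0)
      fun j => s 0 * -PowerSeries.coeff j W * s 0) hWS hSW (by simpa [hS] using hs)
    h0.isUnit (hs 0 (Nat.zero_le _))
    (by simpa [hS] using lowerToeplitz_mul_hankel_mul (n + 1) hWS hSW) ?_
  · have h2 := samePositivity_borderedHankel h0 n fun j => s 0 * -PowerSeries.coeff j W * s 0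
    -- The factor `1 - αX` inside `W` reproduces the `[+,α]`-transform of the Schur transform.
    have h3 : ∀ j, s 0 * -PowerSeries.coeff (j + 2) W * s 0 =
        plusTransform (α : ℂ) (schurTransform (α : ℂ) s) (j + 1) := by
      intro j
      rw [plusTransform, ← schurTransform_eq, ← schurTransform_eq, hW, map_sub,
        PowerSeries.coeff_smul, PowerSeries.coeff_succ_X_mul, ← hR]
      simp only [mul_neg, neg_mul, mul_sub, sub_mul, neg_smul, smul_neg, neg_neg, neg_sub,
        mul_smul_comm, smul_mul_assoc]
      exact sub_eq_add_neg _ _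
    simp only [h3] at h2
    exact ⟨h1.1.trans h2.1, h1.2.trans h2.2⟩
  -- The constant term of `W` inverts `s 0`, so scaling turns the corner block into `s 0`.
  · have hW0 : s 0 * PowerSeries.constantCoeff W = 1 := by
      simpa [hS] using congrArg PowerSeries.constantCoeff hSW
    intro i j
    simp only [borderedHankel, Matrix.of_apply]
    split_ifs
    · rw [hW0, one_mul]
    · simp
    · simp
    · rfl

end Step

/-! ### The classes of sequences -/

section Classes

variable {q : ℕ} {α : ℝ} {s : ℕ → Matrix (Fin q) (Fin q) ℂ} {m : ℕ}

theorem star_eq_of_blockH {n : ℕ} (h : (blockH s n).IsHermitian) :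
    ∀ j ≤ 2 * n, star (s j) = s j := by
  intro j hj
  ext x y
  -- Any two block positions at most `n` with sum `j` would do; halving `j` keeps both in range.
  have h1 := h.apply (⟨j / 2, by omega⟩, x) (⟨j - j / 2, by omega⟩, y)
  simp only [blockH, Matrix.of_apply] at h1
  rw [show j / 2 + (j - j / 2) = j by omega, show j - j / 2 + j / 2 = j by omega] at h1
  exact h1

theorem KNonnegFin.star_eq (h : KNonnegFin α m s) {n : ℕ} (hn : m = 2 * n ∨ m = 2 * n + 1) :
    ∀ j ≤ 2 * n, star (s j) = s j :=
  star_eq_of_blockH (h.1 n hn).1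

theorem posSemidef_of_blockH {n : ℕ} (h : (blockH s n).PosSemidef) : (s 0).PosSemidef :=
  h.submatrix fun x => (0, x)

theorem posDef_of_blockH {n : ℕ} (h : (blockH s n).PosDef) : (s 0).PosDef :=
  h.submatrix (e := fun x => ((0 : Fin (n + 1)), x)) fun _ _ h => (Prod.ext_iff.1 h).2

theorem blockH_zero_submatrix :
    (blockH s 0).submatrix (Equiv.uniqueProd (Fin q) (Fin 1)).symm
      (Equiv.uniqueProd (Fin q) (Fin 1)).symm = s 0 := by
  ext x y
  simp [blockH]

theorem posDef_blockH_zero (h : (s 0).PosDef) : (blockH s 0).PosDef :=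
  (samePositivity_submatrix_equiv (blockH s 0) (Equiv.uniqueProd (Fin q) (Fin 1)).symm).2.1
    (blockH_zero_submatrix ▸ h)

theorem KNonnegFin.posSemidef_zero (h : KNonnegFin α m s) : (s 0).PosSemidef :=
  posSemidef_of_blockH (h.1 (m / 2) (by omega))

theorem KPosFin.posDef_zero (h : KPosFin α m s) : (s 0).PosDef :=
  posDef_of_blockH (h.1 (m / 2) (by omega))

theorem KPosFin.kNonnegFin (h : KPosFin α m s) : KNonnegFin α m s :=
  ⟨fun n hn => (h.1 n hn).posSemidef, fun n hn => (h.2 n hn).posSemidef⟩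

/-- The Schur transform preserves the nonnegative class. -/
theorem KNonnegFin.schurTransform (h : KNonnegFin α (m + 1) s) (h0 : (s 0).PosDef) :
    KNonnegFin α m (schurTransform (α : ℂ) s) := by
  constructor
  · intro n hn
    have hs := h.star_eq (n := (m + 1) / 2) (by omega)
    exact (samePositivity_plusTransform_schurTransform h0.isUnit
      fun j hj => hs j (by omega)).1.1 (h.2 n (by omega))
  · intro n hn
    have hs := h.star_eq (n := n + 1) (by omega)
    exact (samePositivity_blockH_schurTransform h0
      fun j hj => hs j (by omega)).1.1 (h.1 (n + 1) (by omega))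

/-- A nonnegative sequence is positive if and only if its Schur transform is. -/
theorem KNonnegFin.kPosFin_schurTransform_iff (h : KNonnegFin α (m + 1) s) (h0 : (s 0).PosDef) :
    KPosFin α m (StieltjesSchur.schurTransform (α : ℂ) s) ↔ KPosFin α (m + 1) s := by
  have hs := h.star_eq (n := (m + 1) / 2) (by omega)
  have hA : ∀ n, m = 2 * n ∨ m = 2 * n + 1 → _ := fun n hn =>
    (samePositivity_plusTransform_schurTransform (α := α) (n := n) h0.isUnit
      fun j hj => hs j (by omega)).2
  have hB : ∀ n, m = 2 * (n + 1) ∨ m = 2 * n + 1 → _ := fun n hn =>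
    (samePositivity_blockH_schurTransform (α := α) (n := n) h0
      fun j hj => hs j (by omega)).2
  constructor
  · intro ht
    refine ⟨fun n hn => ?_, fun n hn => (hA n (by omega)).2 (ht.1 n (by omega))⟩
    -- `H_0` corresponds to no matrix of the transform; its positivity is that of `s 0`.
    rcases n with _ | n
    · exact posDef_blockH_zero h0
    · exact (hB n (by omega)).2 (ht.2 n (by omega))
  · intro hp
    exact ⟨fun n hn => (hA n hn).1 (hp.2 n (by omega)),
      fun n hn => (hB n hn).1 (hp.1 (n + 1) (by omega))⟩

/-- `schurIter` adds transforms at the outer end, whereas the inductions on the length peel off the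
innermost one. -/
theorem schurIter_schurTransform (α : ℂ) (s : ℕ → Matrix (Fin q) (Fin q) ℂ) (k : ℕ) :
    schurIter α (schurTransform α s) k = schurIter α s (k + 1) := by
  induction k with
  | zero => rfl
  | succ k ih => rw [schurIter, ih, ← schurIter]

theorem KPosFin.posDef_schurIter (h : KPosFin α m s) :
    ∀ k ≤ m, (schurIter (α : ℂ) s k 0).PosDef := by
  induction m generalizing s with
  | zero =>
    intro k hk
    obtain rfl := Nat.le_zero.1 hk
    exact h.posDef_zero
  | succ m ih =>
    rintro (_ | k) hk
    · exact h.posDef_zero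
    · rw [← schurIter_schurTransform]
      exact ih ((h.kNonnegFin.kPosFin_schurTransform_iff h.posDef_zero).2 h) k (by omega)

/-- Nonnegativity upgrades the nonzero determinant of `s 0` to positivity, which is what allows the
next Schur step. -/
theorem KNonnegFin.kPosFin_of_det_ne_zero (h : KNonnegFin α m s)
    (hd : ∀ k ≤ m, (schurIter (α : ℂ) s k 0).det ≠ 0) : KPosFin α m s := by
  induction m generalizing s with
  | zero =>
    have h0 := h.posSemidef_zero.posDef_iff_det_ne_zero.2 (hd 0 le_rfl)
    refine ⟨fun n hn => ?_, fun n hn => by omega⟩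
    obtain rfl : n = 0 := by omega
    exact posDef_blockH_zero h0
  | succ m ih =>
    have h0 := h.posSemidef_zero.posDef_iff_det_ne_zero.2 (hd 0 (Nat.zero_le _))
    refine (h.kPosFin_schurTransform_iff h0).1 (ih (h.schurTransform h0) fun k hk => ?_)
    rw [schurIter_schurTransform]
    exact hd (k + 1) (by omega)

theorem KPos.posDef_schurIter {κ : ℕ∞} (h : KPos α κ s) (k : ℕ) (hk : (k : ℕ∞) ≤ κ) :
    (schurIter (α : ℂ) s k 0).PosDef := by
  induction κ using ENat.recTopCoe with
  | top => exact (h.2 rfl k).posDef_schurIter k le_rfl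
  | coe m => exact (h.1 m rfl).posDef_schurIter k (by exact_mod_cast hk)

theorem KNonneg.kPos_of_det_ne_zero {κ : ℕ∞} (h : KNonneg α κ s)
    (hd : ∀ k : ℕ, (k : ℕ∞) ≤ κ → (schurIter (α : ℂ) s k 0).det ≠ 0) : KPos α κ s := by
  refine ⟨fun m hm => (h.1 m hm).kPosFin_of_det_ne_zero fun k hk => hd k ?_,
    fun hκ m => (h.2 hκ m).kPosFin_of_det_ne_zero fun k _ => hd k (hκ ▸ le_top)⟩
  rw [hm]
  exact_mod_cast hk

theorem corrP_eq_zero {α : ℂ} {k : ℕ} (h : IsUnit (schurIter α s k 0)) (j : ℕ) :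
    corrP α s j k = 0 := by
  rw [corrP, mul_mpInv h, one_mul, mul_assoc, mpInv_mul h, mul_one, sub_self]

end Classes

end StieltjesSchur

end

theorem propositionP1626 (q : ℕ) (α : ℝ) (κ : ℕ∞) (s : ℕ → Matrix (Fin q) (Fin q) ℂ)
    (hs : StieltjesSchur.KNonneg α κ s) :
    (StieltjesSchur.KPos α κ s ↔
      ∀ k : ℕ, (k : ℕ∞) ≤ κ → (StieltjesSchur.schurIter (α : ℂ) s k 0).det ≠ 0) ∧
    (StieltjesSchur.KPos α κ s →
      (∀ k : ℕ, (k : ℕ∞) ≤ κ → (StieltjesSchur.schurIter (α : ℂ) s k 0).PosDef) ∧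
      (∀ k j : ℕ, ((k + j : ℕ) : ℕ∞) ≤ κ → StieltjesSchur.corrP (α : ℂ) s j k = 0) ∧
      (∀ m l : ℕ, m ≤ l → (l : ℕ∞) ≤ κ → StieltjesSchur.corrZ (α : ℂ) s l m = 0)) := by
  refine ⟨⟨fun h k hk => (h.posDef_schurIter k hk).det_pos.ne', hs.kPos_of_det_ne_zero⟩,
    fun h => ⟨h.posDef_schurIter, fun k j hkj => ?_, fun m l hml hl => ?_⟩⟩
  · have hk : (k : ℕ∞) ≤ κ := le_trans (by exact_mod_cast Nat.le_add_right k j) hkj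
    exact StieltjesSchur.corrP_eq_zero (h.posDef_schurIter k hk).isUnit j
  · refine Finset.sum_eq_zero fun k hk => ?_
    have hk' : (k : ℕ∞) ≤ κ :=
      le_trans (by exact_mod_cast (Finset.mem_range.1 hk).le.trans hml) hl
    exact StieltjesSchur.corrP_eq_zero (h.posDef_schurIter k hk').isUnit _
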